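/- Let $\mathcal H,\mathcal K$ be complex Hilbert spaces, let $I\subseteq\mathbb R$ be an interval, and let $f:I\to\mathbb R$ be a continuous function. Write $f(A)$ for the continuous functional calculus of a bounded self-adjoint operator $A$ with spectrum in $I$, and $\le$ for the Loewner order ($A\le B$ iff $B-A$ is positive). The function $f$ is called operator convex on $I$ if $$f((1-v)A+vB)\le(1-v)f(A)+vf(B)\qquad(v\in[0,1])$$ for all bounded self-adjoint operators $A,B$ with spectra in $I$ on any complex Hilbert space, and operator concave on $I$ if the reversed inequality always holds. Let $\Phi_1,\dots,\Phi_n:\mathcal B(\mathcal H)\to\mathcal B(\mathcal K)$ be positive linear maps that are normalized, i.e. $\Phi_i(\mathbf 1_{\mathcal H})=\mathbf 1_{\mathcal K}$, let $A_1,\dots,A_n\in\mathcal B(\mathcal H)$ be self-adjoint operators with spectra contained in $I$, and let $w_1,\dots,w_n$ be positive numbers with $\sum_{i=1}^n w_i=1$. Let $J\subsetneq\{1,\dots,n\}$, $J^c=\{1,\dots,n\}\setminus J$, $\omega_J=\sum_{i\in J}w_i$, $\omega_{J^c}=1-\omega_J$, and $$\Delta=\omega_J\, f\Big(\frac1{\omega_J}\sum_{i\in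 J}w_i\Phi_i(A_i)\Big)+\omega_{J^c}\, f\Big(\frac1{\omega_{J^c}}\sum_{i\in J^c}w_i\Phi_i(A_i)\Big),$$ where the first summand is read as $0$ if $J=\emptyset$. If $f$ is operator convex on $I$, then $$f\Big(\sum_{i=1}^n w_i\Phi_i(A_i)\Big)\le\Delta\le\sum_{i=1}^n w_i\Phi_i(f(A_i)).$$ If $f$ is operator concave on $I$, then both inequalities are reversed: $$f\Big(\sum_{i=1}^n w_i\Phi_i(A_i)\Big)\ge\Delta\ge\sum_{i=1}^n w_i\Phi_i(f(A_i)).$$ -/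

import Mathlib

universe u v

/-- `f` is operator convex on the interval `I`: for every complex Hilbert space `H` and all bounded
self-adjoint operators `A`, `B` on `H` with spectra in `I`,
`f ((1 - v) A + v B) ≤ (1 - v) f(A) + v f(B)` for `v ∈ [0, 1]`.
Here `f(A)` is the continuous functional calculus (for `f` continuous on `I`), and `≤` is the
Loewner order on bounded operators. -/
def IsOperatorConvexOn (I : Set ℝ) (f : ℝ → ℝ) : Prop :=
  ∀ (H : Type u) [NormedAddCommGroup H] [InnerProductSpace ℂ H] [CompleteSpace H]
    (A B : H →L[ℂ] H), IsSelfAdjoint A → IsSelfAdjoint B →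
    spectrum ℝ A ⊆ I → spectrum ℝ B ⊆ I →
    ∀ v ∈ Set.Icc (0 : ℝ) 1,
      cfc f ((1 - v) • A + v • B) ≤ (1 - v) • cfc f A + v • cfc f B

/-- `f` is operator concave on the interval `I`: the reversed inequality holds. -/
def IsOperatorConcaveOn (I : Set ℝ) (f : ℝ → ℝ) : Prop :=
  ∀ (H : Type u) [NormedAddCommGroup H] [InnerProductSpace ℂ H] [CompleteSpace H]
    (A B : H →L[ℂ] H), IsSelfAdjoint A → IsSelfAdjoint B →
    spectrum ℝ A ⊆ I → spectrum ℝ B ⊆ I →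
    ∀ v ∈ Set.Icc (0 : ℝ) 1,
      (1 - v) • cfc f A + v • cfc f B ≤ cfc f ((1 - v) • A + v • B)

/-- For operators `X i` (below `X i = Φ i (A i)`), weights `w` and an index set `J`, with
`ω_J = ∑_{i ∈ J} w i` and `ω_{Jᶜ} = 1 - ω_J`:
`ω_J f(ω_J⁻¹ ∑_{i ∈ J} w i X i) + ω_{Jᶜ} f(ω_{Jᶜ}⁻¹ ∑_{i ∈ Jᶜ} w i X i)`.
If `J = ∅`, then `ω_J = 0` and the first summand is `0`. -/
noncomputable def jensenDelta {K : Type u} [NormedAddCommGroup K] [InnerProductSpace ℂ K]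
    [CompleteSpace K] {n : ℕ} (f : ℝ → ℝ) (w : Fin n → ℝ) (X : Fin n → (K →L[ℂ] K))
    (J : Finset (Fin n)) : K →L[ℂ] K :=
  (∑ i ∈ J, w i) • cfc f ((∑ i ∈ J, w i)⁻¹ • ∑ i ∈ J, w i • X i) +
    (1 - ∑ i ∈ J, w i) • cfc f ((1 - ∑ i ∈ J, w i)⁻¹ • ∑ i ∈ Jᶜ, w i • X i)

/-!
The heart of the matter is the Choi–Davis–Jensen inequality `f (Φ A) ≤ Φ (f A)` for a unital
positive linear map `Φ` and an operator convex `f`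
(`IsOperatorConvexOn.cfc_map_le`). Granted this, the theorem is convexity: on the order interval of
operators between `m` and `M`, which consists of the self-adjoint operators with spectrum in
`[m, M]`, the map `cfc f` is convex in the sense of ordered modules, so Jensen's inequality inside
`J`, inside `Jᶜ`, and for the two resulting averages bounds `jensenDelta` on both sides
(`IsOperatorConvexOn.cfc_sum_le_jensenDelta`). The concave case is the convex case for `-f`.

A positive map need not be completely positive, so no dilation theorem applies to `Φ` itself. Only
its values on functions of `A` matter, however, and these are reached through Bernstein
polynomials: they give nonnegative functions `g j` with sum `1` and points `t j` such that
`∑ j, t j * g j x = x` exactly and `∑ j, f (t j) * g j x` is uniformly close to `f x`. The operators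
`P j = Φ (g j A)` are then positive with sum `1`, and `∑ j, t j • P j = Φ A`, so it suffices to show
`f (∑ j, t j • P j) ≤ ∑ j, f (t j) • P j` (`IsOperatorConvexOn.cfc_sum_smul_le`). Since the first
moment is reproduced exactly, no continuity of `cfc f` in the operator is needed.

This last inequality is `f (V† T V) ≤ V† f(T) V` for the diagonal operator `T` with entries `t j` on
`K ⊕ ⋯ ⊕ K` and the isometry `V x = (√(P j) x)_j`. For any isometry `V` it follows
(`IsOperatorConvexOn.cfc_adjoint_conj_le`) from operator convexity at the midpoint of `T` and
`S T S`, where `S = 2 V V† - 1` is the reflection in the range of `V`: that midpoint leaves the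
range of `V` invariant and acts there as `V† T V`.
-/

/-! ### Bernstein partitions of unity -/

/-- A partition of unity on `[m, M]` with nodes `t j` for which `∑ j, t j * h j` is the identity and
`∑ j, f (t j) * h j` exceeds `f` by at most `ε`: the Bernstein basis, carried over from `[0, 1]`. -/
theorem exists_bernstein_partition {m M : ℝ} (hmM : m ≤ M) {f : ℝ → ℝ}
    (hf : ContinuousOn f (Set.Icc m M)) {ε : ℝ} (hε : 0 < ε) :
    ∃ (N : ℕ) (t : Fin N → ℝ) (h : Fin N → ℝ → ℝ),
      (∀ j, t j ∈ Set.Icc m M) ∧ (∀ j, Continuous (h j)) ∧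
      (∀ j, ∀ x ∈ Set.Icc m M, 0 ≤ h j x) ∧
      (∀ x ∈ Set.Icc m M, ∑ j, h j x = 1) ∧
      (∀ x ∈ Set.Icc m M, ∑ j, t j * h j x = x) ∧
      ∀ x ∈ Set.Icc m M, ∑ j, f (t j) * h j x ≤ f x + ε := by
  have hd : 0 ≤ M - m := sub_nonneg.2 hmM
  have hline : ∀ s : unitInterval, m + (M - m) * s ∈ Set.Icc m M := fun s =>
    ⟨by nlinarith [s.2.1], by nlinarith [s.2.2]⟩
  let g : C(unitInterval, ℝ) :=
    ⟨fun s => f (m + (M - m) * s), hf.comp_continuous (by fun_prop) hline⟩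
  obtain ⟨N, hNg, hN0⟩ := ((Metric.tendsto_nhds.1 (bernsteinApproximation_uniform g) ε hε).and
    (Filter.eventually_ne_atTop 0)).exists
  let u : ℝ → ℝ := fun x => (x - m) / (M - m)
  have hu : ∀ x ∈ Set.Icc m M, u x ∈ unitInterval := fun x hx =>
    ⟨div_nonneg (by linarith [hx.1]) hd, div_le_one_of_le₀ (by linarith [hx.2]) hd⟩
  -- also if `m = M`, where `u x = 0` by division by zero and `x = m`
  have hmu : ∀ x ∈ Set.Icc m M, m + (M - m) * u x = x := by
    intro x hx
    rcases eq_or_ne (M - m) 0 with h0 | h0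
    · rw [h0]; linarith [hx.1, hx.2]
    · simp only [u]; field_simp; ring
  have heval : ∀ (j : ℕ) x (hx : x ∈ Set.Icc m M),
      (bernsteinPolynomial ℝ N j).eval (u x) = bernstein N j ⟨u x, hu x hx⟩ := fun _ _ _ => rfl
  have hone : ∀ x ∈ Set.Icc m M,
      ∑ j : Fin (N + 1), (bernsteinPolynomial ℝ N j).eval (u x) = 1 := by
    intro x hx
    simp_rw [heval _ x hx]
    exact bernstein.probability N _
  refine ⟨N + 1, fun j => m + (M - m) * bernstein.z j,
    fun j x => (bernsteinPolynomial ℝ N j).eval (u x), fun j => hline _, fun j => ?_,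
    fun j x hx => ?_, hone, fun x hx => ?_, fun x hx => ?_⟩
  · exact (Polynomial.continuous _).comp (by fun_prop)
  · simp only [heval _ x hx]; exact bernstein_nonneg
  · have hmean : ∑ j : Fin (N + 1), ((bernstein.z j : unitInterval) : ℝ) *
        (bernsteinPolynomial ℝ N j).eval (u x) = u x := by
      have := congrArg (Polynomial.eval (u x)) (bernsteinPolynomial.sum_smul ℝ N)
      simp only [Polynomial.eval_finsetSum, nsmul_eq_mul, Polynomial.eval_mul,
        Polynomial.eval_natCast, Polynomial.eval_X, Finset.sum_range] at this
      have hN : (N : ℝ) ≠ 0 := Nat.cast_ne_zero.2 hN0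
      simp only [bernstein.z, div_mul_eq_mul_div, ← Finset.sum_div]
      rw [this]
      field_simp
    simp_rw [add_mul, mul_assoc]
    rw [Finset.sum_add_distrib, ← Finset.mul_sum, ← Finset.mul_sum, hone x hx, hmean, mul_one,
      hmu x hx]
  · have hdist := (ContinuousMap.dist_lt_iff hε).1 hNg ⟨u x, hu x hx⟩
    rw [bernsteinApproximation.apply, Real.dist_eq] at hdist
    have hgx : g ⟨u x, hu x hx⟩ = f x := congrArg f (hmu x hx)
    rw [hgx] at hdist
    have hs : ∑ j : Fin (N + 1), f (m + (M - m) * bernstein.z j) *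
        (bernsteinPolynomial ℝ N j).eval (u x) =
        ∑ j : Fin (N + 1), bernstein N j ⟨u x, hu x hx⟩ • g (bernstein.z j) :=
      Finset.sum_congr rfl fun j _ => by rw [heval _ x hx, smul_eq_mul, mul_comm]; rfl
    simp only [hs]
    linarith [(abs_lt.1 hdist).2]

/-! ### Intertwining operators and compressions -/

theorem aeval_comp_of_intertwine {E F : Type*} [NormedAddCommGroup E] [NormedSpace ℂ E]
    [NormedAddCommGroup F] [NormedSpace ℂ F] {B : F →L[ℂ] F} {C : E →L[ℂ] E} {V : E →L[ℂ] F}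
    (h : B ∘L V = V ∘L C) (p : Polynomial ℝ) :
    Polynomial.aeval B p ∘L V = V ∘L Polynomial.aeval C p := by
  induction p using Polynomial.induction_on' with
  | add p q hp hq => simp [ContinuousLinearMap.add_comp, hp, hq]
  | monomial n a =>
    have hpow : ∀ n : ℕ, (B ^ n) ∘L V = V ∘L (C ^ n) := by
      intro n
      induction n with
      | zero => ext x; simp
      | succ n ih =>
        rw [pow_succ, pow_succ', ContinuousLinearMap.mul_def, ContinuousLinearMap.mul_def,
          ContinuousLinearMap.comp_assoc, h, ← ContinuousLinearMap.comp_assoc, ih,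
          ContinuousLinearMap.comp_assoc, ← ContinuousLinearMap.mul_def,
          ← ContinuousLinearMap.mul_def, ← pow_succ, ← pow_succ']
    ext x
    have := congrArg (fun W : E →L[ℂ] F => W x) (hpow n)
    simp only [ContinuousLinearMap.comp_apply] at this
    simp [Polynomial.aeval_monomial, Algebra.algebraMap_eq_smul_one, this]

section
variable {E : Type*} [NormedAddCommGroup E] [InnerProductSpace ℂ E] [CompleteSpace E]
  {F : Type*} [NormedAddCommGroup F] [InnerProductSpace ℂ F] [CompleteSpace F]

/-- The self-adjoint operators with spectrum in `[m, M]` form an order interval. In this form they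
are visibly a convex set, preserved by unital positive maps. -/
theorem mem_Icc_algebraMap_iff {m M : ℝ} {T : E →L[ℂ] E} :
    T ∈ Set.Icc (algebraMap ℝ (E →L[ℂ] E) m) (algebraMap ℝ (E →L[ℂ] E) M) ↔
      IsSelfAdjoint T ∧ spectrum ℝ T ⊆ Set.Icc m M := by
  constructor
  · rintro ⟨h1, h2⟩
    have hT : IsSelfAdjoint T := by
      have := (IsSelfAdjoint.of_nonneg (sub_nonneg.2 h1)).add
        (IsSelfAdjoint.algebraMap (E →L[ℂ] E) (IsSelfAdjoint.all m))
      simpa using this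
    exact ⟨hT, fun x hx => ⟨(algebraMap_le_iff_le_spectrum hT).1 h1 x hx,
      (le_algebraMap_iff_spectrum_le hT).1 h2 x hx⟩⟩
  · rintro ⟨hT, h⟩
    exact ⟨(algebraMap_le_iff_le_spectrum hT).2 fun x hx => (h hx).1,
      (le_algebraMap_iff_spectrum_le hT).2 fun x hx => (h hx).2⟩

open ContinuousLinearMap in
theorem adjoint_conj_mono {S T : F →L[ℂ] F} (h : S ≤ T) (V : E →L[ℂ] F) :
    adjoint V ∘L S ∘L V ≤ adjoint V ∘L T ∘L V := by
  rw [ContinuousLinearMap.le_def] at h ⊢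
  simpa [comp_sub, sub_comp] using h.adjoint_conj V

open ContinuousLinearMap in
theorem adjoint_conj_mem_Icc {m M : ℝ} {T : F →L[ℂ] F} {V : E →L[ℂ] F}
    (hV : adjoint V ∘L V = 1)
    (hT : T ∈ Set.Icc (algebraMap ℝ (F →L[ℂ] F) m) (algebraMap ℝ (F →L[ℂ] F) M)) :
    adjoint V ∘L T ∘L V ∈
      Set.Icc (algebraMap ℝ (E →L[ℂ] E) m) (algebraMap ℝ (E →L[ℂ] E) M) := by
  have key : ∀ r : ℝ, adjoint V ∘L (algebraMap ℝ (F →L[ℂ] F) r) ∘L V =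
      algebraMap ℝ (E →L[ℂ] E) r := by
    intro r
    rw [Algebra.algebraMap_eq_smul_one, Algebra.algebraMap_eq_smul_one, ← hV]
    ext x
    simp
  exact ⟨key m ▸ adjoint_conj_mono hT.1 V, key M ▸ adjoint_conj_mono hT.2 V⟩

/-- An operator that intertwines `B` and `C` intertwines `f(B)` and `f(C)`, because it does so for
polynomials, which approximate `f` uniformly on `[m, M]`. -/
theorem cfc_comp_of_intertwine {m M : ℝ} {f : ℝ → ℝ} (hf : ContinuousOn f (Set.Icc m M))
    {B : F →L[ℂ] F} {C : E →L[ℂ] E} {V : E →L[ℂ] F}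
    (hB : B ∈ Set.Icc (algebraMap ℝ (F →L[ℂ] F) m) (algebraMap ℝ (F →L[ℂ] F) M))
    (hC : C ∈ Set.Icc (algebraMap ℝ (E →L[ℂ] E) m) (algebraMap ℝ (E →L[ℂ] E) M))
    (h : B ∘L V = V ∘L C) : cfc f B ∘L V = V ∘L cfc f C := by
  obtain ⟨hBs, hBI⟩ := mem_Icc_algebraMap_iff.1 hB
  obtain ⟨hCs, hCI⟩ := mem_Icc_algebraMap_iff.1 hC
  have happrox : ∀ ε > 0, ‖cfc f B ∘L V - V ∘L cfc f C‖ ≤ ε * (2 * ‖V‖) := by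
    intro ε hε
    obtain ⟨p, hp⟩ := exists_polynomial_near_of_continuousOn m M f hf ε hε
    have h1 : ‖cfc f B - Polynomial.aeval B p‖ ≤ ε := by
      rw [← cfc_polynomial p B, ← cfc_sub f p.eval B (hf.mono hBI)]
      exact norm_cfc_le hε.le fun x hx => by
        rw [norm_sub_rev]; exact (hp x (hBI hx)).le
    have h2 : ‖Polynomial.aeval C p - cfc f C‖ ≤ ε := by
      rw [← cfc_polynomial p C, ← cfc_sub p.eval f C p.continuousOn (hf.mono hCI)]
      exact norm_cfc_le hε.le fun x hx => (hp x (hCI hx)).le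
    have hsplit : cfc f B ∘L V - V ∘L cfc f C =
        (cfc f B - Polynomial.aeval B p) ∘L V + V ∘L (Polynomial.aeval C p - cfc f C) := by
      rw [ContinuousLinearMap.sub_comp, ContinuousLinearMap.comp_sub,
        aeval_comp_of_intertwine h p]
      abel
    rw [hsplit]
    calc _ ≤ ‖cfc f B - Polynomial.aeval B p‖ * ‖V‖ + ‖V‖ * ‖Polynomial.aeval C p - cfc f C‖ :=
          (norm_add_le _ _).trans (add_le_add (ContinuousLinearMap.opNorm_comp_le _ _)
            (ContinuousLinearMap.opNorm_comp_le _ _))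
      _ ≤ ε * ‖V‖ + ‖V‖ * ε := by gcongr
      _ = ε * (2 * ‖V‖) := by ring
  have hle : ‖cfc f B ∘L V - V ∘L cfc f C‖ ≤ 0 := by
    have ht : Filter.Tendsto (fun ε : ℝ => ε * (2 * ‖V‖)) (nhdsWithin 0 (Set.Ioi 0)) (nhds 0) := by
      have : Filter.Tendsto (fun ε : ℝ => ε * (2 * ‖V‖)) (nhds 0) (nhds (0 * (2 * ‖V‖))) :=
        Filter.tendsto_id.mul_const _
      rw [zero_mul] at this
      exact this.mono_left nhdsWithin_le_nhds
    exact ge_of_tendsto ht (Filter.eventually_of_mem self_mem_nhdsWithin happrox)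
  exact sub_eq_zero.1 (norm_le_zero_iff.1 hle)
end

/-! ### Jensen's inequality for operator convex functions -/

theorem IsOperatorConvexOn.mono {I I' : Set ℝ} {f : ℝ → ℝ} (h : IsOperatorConvexOn.{v} I f)
    (hI : I' ⊆ I) : IsOperatorConvexOn.{v} I' f := by
  intro H _ _ _ A B hA hB hAI hBI
  exact h H A B hA hB (hAI.trans hI) (hBI.trans hI)

theorem PositiveLinearMap.map_mem_Icc {E F : Type*} [NormedAddCommGroup E]
    [InnerProductSpace ℂ E] [NormedAddCommGroup F] [InnerProductSpace ℂ F] {m M : ℝ}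
    (Φ : (E →L[ℂ] E) →ₚ[ℂ] (F →L[ℂ] F))
    (hΦ : Φ 1 = 1) {A : E →L[ℂ] E}
    (hA : A ∈ Set.Icc (algebraMap ℝ (E →L[ℂ] E) m) (algebraMap ℝ (E →L[ℂ] E) M)) :
    Φ A ∈ Set.Icc (algebraMap ℝ (F →L[ℂ] F) m) (algebraMap ℝ (F →L[ℂ] F) M) := by
  have key : ∀ r : ℝ, Φ (algebraMap ℝ (E →L[ℂ] E) r) = algebraMap ℝ (F →L[ℂ] F) r := fun r => by
    rw [Algebra.algebraMap_eq_smul_one, Algebra.algebraMap_eq_smul_one,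
      Φ.map_smul_of_tower, hΦ]
  exact ⟨key m ▸ OrderHomClass.mono Φ hA.1, key M ▸ OrderHomClass.mono Φ hA.2⟩

section
variable {K : Type v} [NormedAddCommGroup K] [InnerProductSpace ℂ K] [CompleteSpace K]

theorem IsOperatorConvexOn.convexOn_cfc {m M : ℝ} {f : ℝ → ℝ}
    (h : IsOperatorConvexOn.{v} (Set.Icc m M) f) :
    ConvexOn ℝ (Set.Icc (algebraMap ℝ (K →L[ℂ] K) m) (algebraMap ℝ (K →L[ℂ] K) M)) (cfc f) := by
  refine ⟨convex_Icc _ _, fun A hA B hB a b ha hb hab => ?_⟩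
  obtain ⟨hA1, hA2⟩ := mem_Icc_algebraMap_iff.1 hA
  obtain ⟨hB1, hB2⟩ := mem_Icc_algebraMap_iff.1 hB
  obtain rfl : a = 1 - b := by linarith
  exact h K A B hA1 hB1 hA2 hB2 b ⟨hb, by linarith⟩

open ContinuousLinearMap in
/-- Jensen's operator inequality for compression by an isometry `V`. -/
theorem IsOperatorConvexOn.cfc_adjoint_conj_le {L : Type v} [NormedAddCommGroup L]
    [InnerProductSpace ℂ L] [CompleteSpace L] {m M : ℝ} {f : ℝ → ℝ}
    (h : IsOperatorConvexOn.{v} (Set.Icc m M) f) (hf : ContinuousOn f (Set.Icc m M))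
    {V : K →L[ℂ] L} (hV : adjoint V ∘L V = 1) {T : L →L[ℂ] L}
    (hT : T ∈ Set.Icc (algebraMap ℝ (L →L[ℂ] L) m) (algebraMap ℝ (L →L[ℂ] L) M)) :
    cfc f (adjoint V ∘L T ∘L V) ≤ adjoint V ∘L cfc f T ∘L V := by
  have hVx : ∀ x, adjoint V (V x) = x := fun x => congrArg (fun W : K →L[ℂ] K => W x) hV
  -- the reflection in the range of `V`
  let S : L →L[ℂ] L := (2 : ℝ) • (V ∘L adjoint V) - 1
  have hSa : adjoint S = S := by
    have h2 : IsSelfAdjoint S := by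
      refine IsSelfAdjoint.sub (IsSelfAdjoint.smul (IsSelfAdjoint.all _) ?_) (IsSelfAdjoint.one _)
      rw [isSelfAdjoint_iff', adjoint_comp, adjoint_adjoint]
    exact h2.adjoint_eq
  have hSx : ∀ x, S x = (2 : ℝ) • V (adjoint V x) - x := fun x => by simp [S]
  have hSS : ∀ x, S (S x) = x := by
    intro x
    rw [hSx (S x), hSx x]
    simp only [map_sub, map_smul_of_tower, hVx]
    module
  have hSV : S ∘L V = V := by
    ext x
    rw [comp_apply, hSx, hVx, two_smul, add_sub_cancel_right]
  have hVS : adjoint V ∘L S = adjoint V := by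
    have := congrArg adjoint hSV
    rwa [adjoint_comp, hSa] at this
  have hSTS : S ∘L T ∘L S ∈
      Set.Icc (algebraMap ℝ (L →L[ℂ] L) m) (algebraMap ℝ (L →L[ℂ] L) M) := by
    have := adjoint_conj_mem_Icc (V := S) (by rw [hSa]; ext x; exact hSS x) hT
    rwa [hSa] at this
  have hC := adjoint_conj_mem_Icc hV hT
  have h12 : (0 : ℝ) ≤ 1 / 2 := by norm_num
  have hB := convex_Icc _ _ hT hSTS h12 h12 (add_halves 1)
  have hconv := (h.convexOn_cfc (K := L)).2 hT hSTS h12 h12 (add_halves 1)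
  -- the range of `V` reduces the average of `T` and `S T S`
  have hBV : cfc f ((1 / 2 : ℝ) • T + (1 / 2 : ℝ) • (S ∘L T ∘L S)) ∘L V =
      V ∘L cfc f (adjoint V ∘L T ∘L V) := by
    refine cfc_comp_of_intertwine hf hB hC ?_
    rw [add_comp, smul_comp, smul_comp, comp_assoc, comp_assoc, hSV]
    ext x
    simp only [add_apply, smul_apply, comp_apply, hSx]
    module
  have hfS : cfc f (S ∘L T ∘L S) ∘L S = S ∘L cfc f T :=
    cfc_comp_of_intertwine hf hSTS hT (by ext x; simp [hSS])
  have hfSV : adjoint V ∘L cfc f (S ∘L T ∘L S) ∘L V = adjoint V ∘L cfc f T ∘L V := by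
    have : cfc f (S ∘L T ∘L S) ∘L V = S ∘L cfc f T ∘L V := by
      rw [← comp_assoc S (cfc f T), ← hfS, comp_assoc (cfc f _), hSV]
    rw [this, ← comp_assoc, hVS]
  calc cfc f (adjoint V ∘L T ∘L V)
      = adjoint V ∘L cfc f ((1 / 2 : ℝ) • T + (1 / 2 : ℝ) • (S ∘L T ∘L S)) ∘L V := by
        rw [hBV, ← comp_assoc (adjoint V) V _, hV, one_def, id_comp]
    _ ≤ adjoint V ∘L ((1 / 2 : ℝ) • cfc f T + (1 / 2 : ℝ) • cfc f (S ∘L T ∘L S)) ∘L V :=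
        adjoint_conj_mono hconv V
    _ = (1 / 2 : ℝ) • (adjoint V ∘L cfc f T ∘L V) +
          (1 / 2 : ℝ) • (adjoint V ∘L cfc f (S ∘L T ∘L S) ∘L V) := by
        ext x
        simp
    _ = adjoint V ∘L cfc f T ∘L V := by
        rw [hfSV, ← add_smul, add_halves, one_smul]

open scoped InnerProductSpace in
open ContinuousLinearMap in
/-- Jensen's inequality for numbers `t j` with positive operators of sum `1` as weights. It is the
compression inequality for the diagonal operator with entries `t j` on the Hilbert sum of copies of
`K`. -/
theorem IsOperatorConvexOn.cfc_sum_smul_le {N : ℕ} {m M : ℝ} {f : ℝ → ℝ}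
    (h : IsOperatorConvexOn.{v} (Set.Icc m M) f) (hf : ContinuousOn f (Set.Icc m M))
    {t : Fin N → ℝ} (ht : ∀ j, t j ∈ Set.Icc m M) {P : Fin N → (K →L[ℂ] K)}
    (hP : ∀ j, 0 ≤ P j) (hP1 : ∑ j, P j = 1) :
    cfc f (∑ j, t j • P j) ≤ ∑ j, f (t j) • P j := by
  let L := PiLp 2 (fun _ : Fin N => K)
  let e : L ≃L[ℂ] (Fin N → K) := PiLp.continuousLinearEquiv 2 ℂ (fun _ : Fin N => K)
  let Q : Fin N → (K →L[ℂ] K) := fun j => CFC.sqrt (P j)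
  let V : K →L[ℂ] L := (e.symm : (Fin N → K) →L[ℂ] L) ∘L ContinuousLinearMap.pi Q
  let D : (Fin N → ℝ) → (L →L[ℂ] L) := fun s => (e.symm : (Fin N → K) →L[ℂ] L) ∘L
    ContinuousLinearMap.pi (fun j => s j • PiLp.proj 2 (𝕜 := ℂ) (fun _ : Fin N => K) j)
  have hVj : ∀ x j, V x j = Q j x := fun x j => rfl
  have hDj : ∀ s x j, D s x j = s j • x j := fun s x j => rfl
  have hinner : ∀ x y : L, ⟪x, y⟫_ℂ = ∑ j, ⟪x j, y j⟫_ℂ := fun x y => PiLp.inner_apply x y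
  have hQ : ∀ j x y, ⟪Q j x, Q j y⟫_ℂ = ⟪P j x, y⟫_ℂ := by
    intro j x y
    have hQa : adjoint (Q j) = Q j :=
      (IsSelfAdjoint.of_nonneg (CFC.sqrt_nonneg (P j))).adjoint_eq
    rw [← adjoint_inner_left, hQa, ← mul_apply_eq_comp,
      CFC.sqrt_mul_sqrt_self (P j) (hP j)]
  have hcompr : ∀ (R : L →L[ℂ] L) (s : Fin N → ℝ), (∀ x j, R x j = s j • x j) →
      adjoint V ∘L R ∘L V = ∑ j, s j • P j := by
    intro R s hR
    ext x
    refine ext_inner_right ℂ fun y => ?_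
    simp only [comp_apply, adjoint_inner_left, hinner, hR, hVj,
      sum_apply, smul_apply, sum_inner, ← Complex.coe_smul, inner_smul_left, hQ]
  have hV : adjoint V ∘L V = 1 := by
    have := hcompr 1 1 (fun x j => by simp)
    simpa [hP1, one_def] using this
  have hmono : ∀ s s' : Fin N → ℝ, (∀ j, s j ≤ s' j) → D s ≤ D s' := by
    intro s s' hs
    rw [ContinuousLinearMap.le_def, isPositive_iff_complex]
    intro x
    have : ⟪(D s' - D s) x, x⟫_ℂ = ((∑ j, (s' j - s j) * ‖x j‖ ^ 2 : ℝ) : ℂ) := by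
      have hsub : ∀ j, (D s' - D s) x j = (s' j - s j) • x j := fun j =>
        (sub_smul (s' j) (s j) (x j)).symm
      simp only [hinner, hsub, ← Complex.coe_smul, inner_smul_left, inner_self_eq_norm_sq_to_K]
      simp
    rw [this]
    refine ⟨by rw [RCLike.re_to_complex, Complex.ofReal_re], ?_⟩
    rw [RCLike.re_to_complex, Complex.ofReal_re]
    exact Finset.sum_nonneg fun j _ => mul_nonneg (sub_nonneg.2 (hs j)) (sq_nonneg _)
  have hconst : ∀ r : ℝ, D (fun _ => r) = algebraMap ℝ (L →L[ℂ] L) r := by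
    intro r
    rw [Algebra.algebraMap_eq_smul_one]
    rfl
  have hD : D t ∈ Set.Icc (algebraMap ℝ (L →L[ℂ] L) m) (algebraMap ℝ (L →L[ℂ] L) M) :=
    ⟨hconst m ▸ hmono _ _ fun j => (ht j).1, hconst M ▸ hmono _ _ fun j => (ht j).2⟩
  -- each coordinate projection intertwines `D t` with a scalar operator
  have hfD : ∀ x j, cfc f (D t) x j = f (t j) • x j := by
    intro x j
    let π : L →L[ℂ] K := PiLp.proj 2 (𝕜 := ℂ) (fun _ : Fin N => K) j
    have := cfc_comp_of_intertwine hf (V := π)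
      (B := algebraMap ℝ (K →L[ℂ] K) (t j)) (C := D t)
      ⟨algebraMap_mono _ (ht j).1, algebraMap_mono _ (ht j).2⟩ hD
      (by rw [Algebra.algebraMap_eq_smul_one]; ext y; rfl)
    rw [cfc_algebraMap, Algebra.algebraMap_eq_smul_one] at this
    exact (congrArg (fun W : L →L[ℂ] K => W x) this).symm
  rw [← hcompr (D t) t (hDj t), ← hcompr (cfc f (D t)) (fun j => f (t j)) hfD]
  exact h.cfc_adjoint_conj_le hf hV hD

variable {H : Type u} [NormedAddCommGroup H] [InnerProductSpace ℂ H] [CompleteSpace H]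

/-- The Choi–Davis–Jensen inequality for unital positive linear maps. The Hilbert space `H` may live
in another universe than the one in which `f` is assumed operator convex. -/
theorem IsOperatorConvexOn.cfc_map_le {m M : ℝ} (hmM : m ≤ M) {f : ℝ → ℝ}
    (h : IsOperatorConvexOn.{v} (Set.Icc m M) f) (hf : ContinuousOn f (Set.Icc m M))
    (Φ : (H →L[ℂ] H) →ₚ[ℂ] (K →L[ℂ] K)) (hΦ : Φ 1 = 1) {A : H →L[ℂ] H}
    (hA : A ∈ Set.Icc (algebraMap ℝ (H →L[ℂ] H) m) (algebraMap ℝ (H →L[ℂ] H) M)) :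
    cfc f (Φ A) ≤ Φ (cfc f A) := by
  obtain ⟨hAs, hAI⟩ := mem_Icc_algebraMap_iff.1 hA
  have happrox : ∀ ε : ℝ, 0 < ε → cfc f (Φ A) ≤ Φ (cfc f A) + ε • (1 : K →L[ℂ] K) := by
    intro ε hε
    obtain ⟨N, t, g, ht, hgc, hg0, hg1, hgt, hgf⟩ := exists_bernstein_partition hmM hf hε
    have hsum : ∀ c : Fin N → ℝ,
        ∑ j, c j • cfc (g j) A = cfc (fun x => ∑ j, c j * g j x) A := by
      intro c
      have hfun : (fun x => ∑ j, c j * g j x) = ∑ j, fun x => c j * g j x := by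
        ext x; simp
      rw [hfun, cfc_sum_univ (fun j x => c j * g j x) A
        (fun j => (continuous_const.mul (hgc j)).continuousOn)]
      exact Finset.sum_congr rfl fun j _ => (cfc_const_mul (c j) (g j) A (hgc j).continuousOn).symm
    have hsumΦ : ∀ c : Fin N → ℝ,
        ∑ j, c j • Φ (cfc (g j) A) = Φ (cfc (fun x => ∑ j, c j * g j x) A) := by
      intro c
      rw [← hsum, map_sum]
      exact Finset.sum_congr rfl fun j _ => (Φ.map_smul_of_tower (c j) _).symm
    have hP1 : ∑ j, Φ (cfc (g j) A) = 1 := by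
      have := hsumΦ 1
      simp only [Pi.one_apply, one_smul, one_mul] at this
      rw [this, cfc_congr (g := fun _ => 1) (fun x hx => hg1 x (hAI hx)), cfc_const_one ℝ A, hΦ]
    have hPt : ∑ j, t j • Φ (cfc (g j) A) = Φ A := by
      rw [hsumΦ, cfc_congr (g := id) (fun x hx => hgt x (hAI hx)), cfc_id ℝ A]
    calc cfc f (Φ A) = cfc f (∑ j, t j • Φ (cfc (g j) A)) := by rw [hPt]
      _ ≤ ∑ j, f (t j) • Φ (cfc (g j) A) := h.cfc_sum_smul_le hf ht
          (fun j => Φ.map_nonneg (cfc_nonneg fun x hx => hg0 j x (hAI hx))) hP1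
      _ = Φ (cfc (fun x => ∑ j, f (t j) * g j x) A) := hsumΦ _
      _ ≤ Φ (cfc (fun x => f x + ε) A) := by
          refine OrderHomClass.mono Φ (cfc_mono (fun x hx => hgf x (hAI hx)) ?_ ?_)
          · exact (continuous_finsetSum _ fun j _ => continuous_const.mul (hgc j)).continuousOn
          · exact (hf.mono hAI).add continuousOn_const
      _ = Φ (cfc f A) + ε • (1 : K →L[ℂ] K) := by
          rw [cfc_add_const ε f A (hf.mono hAI), map_add, Algebra.algebraMap_eq_smul_one,
            Φ.map_smul_of_tower, hΦ]
  have ht : Filter.Tendsto (fun ε : ℝ => Φ (cfc f A) + ε • (1 : K →L[ℂ] K))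
      (nhdsWithin 0 (Set.Ioi 0)) (nhds (Φ (cfc f A))) := by
    have : Continuous fun ε : ℝ => Φ (cfc f A) + ε • (1 : K →L[ℂ] K) := by fun_prop
    simpa using (this.tendsto 0).mono_left nhdsWithin_le_nhds
  exact ge_of_tendsto ht (Filter.eventually_of_mem self_mem_nhdsWithin happrox)
end

/-! ### Averages over an index set and its complement -/

theorem IsOperatorConcaveOn.neg {I : Set ℝ} {f : ℝ → ℝ} (h : IsOperatorConcaveOn.{v} I f) :
    IsOperatorConvexOn.{v} I (fun x => -f x) := by
  intro H _ _ _ A B hA hB hAI hBI r hr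
  simp only [cfc_neg, smul_neg, ← neg_add]
  exact neg_le_neg (h H A B hA hB hAI hBI r hr)

section
variable {K : Type v} [NormedAddCommGroup K] [InnerProductSpace ℂ K] [CompleteSpace K]

theorem jensenDelta_neg {n : ℕ} (f : ℝ → ℝ) (w : Fin n → ℝ) (X : Fin n → (K →L[ℂ] K))
    (J : Finset (Fin n)) : jensenDelta (fun x => -f x) w X J = -jensenDelta f w X J := by
  simp only [jensenDelta, cfc_neg, smul_neg, neg_add]

/-- Finitely many spectra contained in an interval lie in a compact subinterval, bounded by the
extreme points of their union. -/
theorem exists_Icc_of_spectrum_subset {H : Type u} [NormedAddCommGroup H] [InnerProductSpace ℂ H]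
    [CompleteSpace H] [Nontrivial H] {I : Set ℝ} (hI : I.OrdConnected) {n : ℕ} [NeZero n]
    {A : Fin n → (H →L[ℂ] H)} (hA : ∀ i, IsSelfAdjoint (A i)) (hAI : ∀ i, spectrum ℝ (A i) ⊆ I) :
    ∃ m M : ℝ, m ≤ M ∧ Set.Icc m M ⊆ I ∧ ∀ i, spectrum ℝ (A i) ⊆ Set.Icc m M := by
  have hc : IsCompact (⋃ i, spectrum ℝ (A i)) :=
    isCompact_iUnion fun i => spectrum.isCompact (𝕜 := ℝ) (A i)
  have hne : (⋃ i, spectrum ℝ (A i)).Nonempty := by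
    obtain ⟨x, hx⟩ := ContinuousFunctionalCalculus.spectrum_nonempty (R := ℝ) (A 0) (hA 0)
    exact ⟨x, Set.mem_iUnion.2 ⟨0, hx⟩⟩
  have hsub : (⋃ i, spectrum ℝ (A i)) ⊆ I := Set.iUnion_subset hAI
  exact ⟨_, _, csInf_le_csSup hne hc.bddBelow hc.bddAbove,
    hI.out (hsub (hc.sInf_mem hne)) (hsub (hc.sSup_mem hne)),
    fun i x hx => ⟨csInf_le hc.bddBelow (Set.mem_iUnion.2 ⟨i, hx⟩),
      le_csSup hc.bddAbove (Set.mem_iUnion.2 ⟨i, hx⟩)⟩⟩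

theorem inv_smul_sum_mem {E ι : Type*} [AddCommGroup E] [Module ℝ E] {s : Set E}
    (hs : Convex ℝ s) {J : Finset ι} {w : ι → ℝ} (hw : ∀ i ∈ J, 0 ≤ w i) (hJ : 0 < ∑ i ∈ J, w i)
    {X : ι → E} (hX : ∀ i ∈ J, X i ∈ s) :
    (∑ i ∈ J, w i)⁻¹ • ∑ i ∈ J, w i • X i ∈ s :=
  hs.centerMass_mem hw hJ hX

theorem ConvexOn.smul_map_centerMass_le {E F ι : Type*} [AddCommGroup E] [Module ℝ E]
    [AddCommGroup F] [PartialOrder F] [IsOrderedAddMonoid F] [Module ℝ F]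
    [IsStrictOrderedModule ℝ F] {s : Set E} {g : E → F}
    (hg : ConvexOn ℝ s g) {J : Finset ι} {w : ι → ℝ} (hw : ∀ i ∈ J, 0 ≤ w i)
    (hJ : 0 < ∑ i ∈ J, w i) {X : ι → E} (hX : ∀ i ∈ J, X i ∈ s) :
    (∑ i ∈ J, w i) • g ((∑ i ∈ J, w i)⁻¹ • ∑ i ∈ J, w i • X i) ≤ ∑ i ∈ J, w i • g (X i) := by
  have h : g ((∑ i ∈ J, w i)⁻¹ • ∑ i ∈ J, w i • X i) ≤
      (∑ i ∈ J, w i)⁻¹ • ∑ i ∈ J, w i • g (X i) := hg.map_centerMass_le hw hJ hX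
  have := smul_le_smul_of_nonneg_left h hJ.le
  rwa [smul_inv_smul₀ hJ.ne'] at this

theorem IsOperatorConvexOn.cfc_sum_le_jensenDelta {m M : ℝ} {f : ℝ → ℝ}
    (h : IsOperatorConvexOn.{v} (Set.Icc m M) f) {n : ℕ} {w : Fin n → ℝ} (hw : ∀ i, 0 < w i)
    (hw1 : ∑ i, w i = 1) {X : Fin n → (K →L[ℂ] K)}
    (hX : ∀ i, X i ∈ Set.Icc (algebraMap ℝ (K →L[ℂ] K) m) (algebraMap ℝ (K →L[ℂ] K) M))
    {J : Finset (Fin n)} (hJ : J ⊂ Finset.univ) :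
    cfc f (∑ i, w i • X i) ≤ jensenDelta f w X J ∧
      jensenDelta f w X J ≤ ∑ i, w i • cfc f (X i) := by
  have hconv := h.convexOn_cfc (K := K)
  have hcompl : ∑ i ∈ Jᶜ, w i = 1 - ∑ i ∈ J, w i :=
    eq_sub_of_add_eq' ((Finset.sum_add_sum_compl J w).trans hw1)
  have hne : Jᶜ.Nonempty := by
    rw [Finset.nonempty_iff_ne_empty, Ne, Finset.compl_eq_empty_iff]
    exact hJ.ne
  have hc0 : 0 < ∑ i ∈ Jᶜ, w i := Finset.sum_pos (fun i _ => hw i) hne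
  have hmemc := inv_smul_sum_mem hconv.1 (fun i _ => (hw i).le) hc0 (fun i _ => hX i)
  have hlec := hconv.smul_map_centerMass_le (fun i _ => (hw i).le) hc0 (fun i _ => hX i)
  rw [jensenDelta, ← hcompl, ← Finset.sum_add_sum_compl J (fun i => w i • X i),
    ← Finset.sum_add_sum_compl J (fun i => w i • cfc f (X i))]
  -- for `J = ∅` the first average need not lie in the order interval, but its weight is `0`
  rcases J.eq_empty_or_nonempty with rfl | hJne
  · have h1 : ∑ i ∈ (∅ : Finset (Fin n))ᶜ, w i = 1 := by simpa using hw1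
    simp only [Finset.sum_empty, zero_smul, zero_add]
    refine ⟨?_, hlec⟩
    rw [h1, inv_one, one_smul, one_smul]
  · have h0 : 0 < ∑ i ∈ J, w i := Finset.sum_pos (fun i _ => hw i) hJne
    have hmem := inv_smul_sum_mem hconv.1 (fun i _ => (hw i).le) h0 (fun i _ => hX i)
    have hle := hconv.smul_map_centerMass_le (fun i _ => (hw i).le) h0 (fun i _ => hX i)
    refine ⟨?_, add_le_add hle hlec⟩
    have := hconv.2 hmem hmemc h0.le hc0.le (by rw [hcompl]; ring)
    rwa [smul_inv_smul₀ h0.ne', smul_inv_smul₀ hc0.ne'] at this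

theorem IsOperatorConvexOn.jensenDelta_bounds {H : Type u} [NormedAddCommGroup H]
    [InnerProductSpace ℂ H] [CompleteSpace H] {I : Set ℝ} (hI : I.OrdConnected) {f : ℝ → ℝ}
    (hf : ContinuousOn f I) (h : IsOperatorConvexOn.{v} I f)
    {n : ℕ} {Φ : Fin n → ((H →L[ℂ] H) →ₚ[ℂ] (K →L[ℂ] K))} (hΦ : ∀ i, Φ i 1 = 1)
    {A : Fin n → (H →L[ℂ] H)} (hA : ∀ i, IsSelfAdjoint (A i)) (hAI : ∀ i, spectrum ℝ (A i) ⊆ I)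
    {w : Fin n → ℝ} (hw : ∀ i, 0 < w i) (hw1 : ∑ i, w i = 1)
    {J : Finset (Fin n)} (hJ : J ⊂ Finset.univ) :
    cfc f (∑ i, w i • Φ i (A i)) ≤ jensenDelta f w (fun i => Φ i (A i)) J ∧
      jensenDelta f w (fun i => Φ i (A i)) J ≤ ∑ i, w i • Φ i (cfc f (A i)) := by
  -- nontriviality of `K`, hence of `H`, makes the spectra nonempty
  rcases subsingleton_or_nontrivial K with hK | hK
  · exact ⟨(Subsingleton.elim _ _).le, (Subsingleton.elim _ _).le⟩
  have : NeZero n := ⟨by rintro rfl; simp at hw1⟩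
  have : Nontrivial H := by
    by_contra hH
    rw [not_nontrivial_iff_subsingleton] at hH
    have h10 : (1 : K →L[ℂ] K) = 0 := by
      rw [← hΦ 0, Subsingleton.elim (1 : H →L[ℂ] H) 0, map_zero]
    exact one_ne_zero h10
  obtain ⟨m, M, hmM, hmMI, hAmM⟩ := exists_Icc_of_spectrum_subset hI hA hAI
  have h' := h.mono hmMI
  have hA' := fun i => mem_Icc_algebraMap_iff.2 ⟨hA i, hAmM i⟩
  obtain ⟨h1, h2⟩ := h'.cfc_sum_le_jensenDelta hw hw1
    (fun i => (Φ i).map_mem_Icc (hΦ i) (hA' i)) hJ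
  exact ⟨h1, h2.trans (Finset.sum_le_sum fun i _ => smul_le_smul_of_nonneg_left
    (h'.cfc_map_le hmM (hf.mono hmMI) (Φ i) (hΦ i) (hA' i)) (hw i).le)⟩
end

theorem mainTheorem2 {H : Type u} [NormedAddCommGroup H] [InnerProductSpace ℂ H]
    [CompleteSpace H] {K : Type v} [NormedAddCommGroup K] [InnerProductSpace ℂ K]
    [CompleteSpace K] (I : Set ℝ) (hI : I.OrdConnected) (f : ℝ → ℝ) (hf : ContinuousOn f I)
    (n : ℕ) (Φ : Fin n → ((H →L[ℂ] H) →ₚ[ℂ] (K →L[ℂ] K))) (hΦ : ∀ i, Φ i 1 = 1)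
    (A : Fin n → (H →L[ℂ] H)) (hA : ∀ i, IsSelfAdjoint (A i))
    (hAI : ∀ i, spectrum ℝ (A i) ⊆ I)
    (w : Fin n → ℝ) (hw : ∀ i, 0 < w i) (hw1 : ∑ i, w i = 1)
    (J : Finset (Fin n)) (hJ : J ⊂ Finset.univ) :
    (IsOperatorConvexOn.{v} I f →
      cfc f (∑ i, w i • Φ i (A i)) ≤ jensenDelta f w (fun i => Φ i (A i)) J ∧
      jensenDelta f w (fun i => Φ i (A i)) J ≤ ∑ i, w i • Φ i (cfc f (A i))) ∧
    (IsOperatorConcaveOn.{v} I f →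
      jensenDelta f w (fun i => Φ i (A i)) J ≤ cfc f (∑ i, w i • Φ i (A i)) ∧
      ∑ i, w i • Φ i (cfc f (A i)) ≤ jensenDelta f w (fun i => Φ i (A i)) J) := by

  refine ⟨fun h => h.jensenDelta_bounds hI hf hΦ hA hAI hw hw1 hJ, fun h => ?_⟩
  have hneg : ContinuousOn (fun x => -f x) I := hf.neg
  have := h.neg.jensenDelta_bounds hI hneg hΦ hA hAI hw hw1 hJ
  simpa only [cfc_neg, jensenDelta_neg, map_neg, smul_neg, Finset.sum_neg_distrib,
    neg_le_neg_iff] using this
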